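/- For every error probability $0\le\delta<1/2$ there is a constant $c>0$ (depending on $\delta$ only) such that the following holds for every real $\alpha>1$, all integers $n\ge 2$ and $p\ge 1$, and every integer $W\ge 2\alpha n$. Let $\mathcal A$ be a randomized $p$-pass streaming algorithm with $S$ bits of memory that, whenever its input is a graph stream of a connected simple graph $G$ on $n$ vertices with edge weights in $\{1,\dots,W\}$ (that is, a list, in arbitrary order, of all edges of $G$ with their weights, each edge exactly once), outputs a random real number $Y$ with $$\Pr\big[\,Y\le \mathsf{MST}(G)\le \alpha\cdot Y\,\big]\ \ge\ 1-\delta ,$$ where $\mathsf{MST}(G)$ is the minimum total weight of a spanning tree of $G$. Then $$S\ \ge\ c\cdot\frac{n}{p}.$$ In other words, any randomized $p$-pass $\alpha$-approximation streaming algorithm for MST cost estimation in graph streams requires $\Omega(n/p)$ (in particular $\tilde\Omega(n/p)$) space. Here a deterministic $p$-pass streaming algorithm with $S$ bits of memory consists of an initial memory content in $\{0,1\}^S$, an arbitrary update function that computes the new memory content from the old one, the current stream element, the position in the stream and the number of the current pass, and an arbitrary output function of the memory content after the last pass. A randomized algorithm is a random variable with values in the deterministic ones (so its random bits are not charged as memory),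 such that its output on each of these graph streams is a random variable. -/

import Mathlib

open MeasureTheory

section MinimumSpanningTree

variable {V : Type*} [Fintype V]

open Classical in
/-- The total weight of the edges of a graph `T`, for the edge weights `w`. -/
noncomputable def totalWeight (w : Sym2 V → ℕ) (T : SimpleGraph V) : ℕ :=
  ∑ e ∈ T.edgeFinset, w e

/-- The set of the costs of the spanning trees of `G`. -/
def spanningTreeCosts (G : SimpleGraph V) (w : Sym2 V → ℕ) : Set ℕ :=
  {c | ∃ T : SimpleGraph V, T ≤ G ∧ T.IsTree ∧ c = totalWeight w T}

/-- The cost of a minimum spanning tree of the weighted graph `(G, w)`; it is used for connected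
graphs only, and then the infimum is a minimum, see `isLeast_mstCost`. -/
noncomputable def mstCost (G : SimpleGraph V) (w : Sym2 V → ℕ) : ℕ :=
  sInf (spanningTreeCosts G w)

theorem isLeast_mstCost (G : SimpleGraph V) (w : Sym2 V → ℕ) (hG : G.Connected) :
    IsLeast (spanningTreeCosts G w) (mstCost G w) := by
  obtain ⟨T, hTG, hT⟩ := hG.exists_isTree_le
  exact ⟨Nat.sInf_mem ⟨_, T, hTG, hT, rfl⟩, fun _ hc => Nat.sInf_le hc⟩

end MinimumSpanningTree

/-- An element of a graph stream on `n` vertices: an edge together with its weight. -/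
abbrev StreamEdge (n : ℕ) : Type := Sym2 (Fin n) × ℕ

/-- `l` is a graph stream of the weighted graph `(G, w)`: it lists every edge of `G` exactly once,
together with its weight, in an arbitrary order. -/
def IsGraphStream {n : ℕ} (G : SimpleGraph (Fin n)) (w : Sym2 (Fin n) → ℕ)
    (l : List (StreamEdge n)) : Prop :=
  l.Nodup ∧ ∀ t : StreamEdge n, t ∈ l ↔ t.1 ∈ G.edgeSet ∧ t.2 = w t.1

/-- A deterministic (non-uniform) streaming algorithm that makes `p` passes over a stream of
elements of `T`, uses `S` bits of memory, and outputs a real number. The number of the current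
pass and the position in the stream are known to it free of charge. -/
structure StreamAlg (T : Type*) (p S : ℕ) where
  /-- the initial content of the memory -/
  init : Fin S → Bool
  /-- the new content of the memory, from the number of the pass, the position in the stream, the
  old content of the memory and the current stream element -/
  step : Fin p → ℕ → (Fin S → Bool) → T → (Fin S → Bool)
  /-- the output, from the content of the memory after the last pass -/
  output : (Fin S → Bool) → ℝ

namespace StreamAlg

variable {T : Type*} {p S : ℕ}

/-- The memory after pass number `j` over the stream `l`, if it is `s` before that pass. -/
def runPass (A : StreamAlg T p S) (l : List T) (s : Fin S → Bool) (j : Fin p) : Fin S → Bool :=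
  l.zipIdx.foldl (fun s x => A.step j x.2 s x.1) s

/-- The output of the algorithm after `p` passes over the stream `l`. -/
def run (A : StreamAlg T p S) (l : List T) : ℝ :=
  A.output ((List.finRange p).foldl (A.runPass l) A.init)

end StreamAlg

/-- `Y` is an `α`-approximation of the number `m`. -/
def IsApprox (α m Y : ℝ) : Prop := Y ≤ m ∧ m ≤ α * Y

/-- The randomized streaming algorithm `A`, a random variable on the probability space `(Ω, μ)` with
values in the deterministic algorithms, is an `α`-approximation algorithm with error probability at
most `δ` for MST cost estimation in graph streams on `n` vertices with edge weights in
`{1, …, W}`: on every graph stream of every connected such graph its output is a random variable,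
which is an `α`-approximation of the MST cost with probability at least `1 - δ`. -/
def ApproximatesMST {n p S : ℕ} (W : ℕ) (α δ : ℝ) {Ω : Type*} [MeasurableSpace Ω] (μ : Measure Ω)
    (A : Ω → StreamAlg (StreamEdge n) p S) : Prop :=
  ∀ (G : SimpleGraph (Fin n)) (w : Sym2 (Fin n) → ℕ), G.Connected →
    (∀ e ∈ G.edgeSet, 1 ≤ w e ∧ w e ≤ W) →
    ∀ l : List (StreamEdge n), IsGraphStream G w l →
      Measurable (fun ω => (A ω).run l) ∧
      1 - δ ≤ μ.real {ω | IsApprox α (mstCost G w : ℝ) ((A ω).run l)}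

/-! The proof reduces the inner product modulo 2 of two `k`-bit vectors, with `k` about `n / 4`, to
MST estimation. The input is the complete graph with weights 1 (light) and `W`. If the light edges
connect everything, the MST costs less than `n`; otherwise it costs at least `W ≥ 2αn`. So an
`α`-approximation reveals whether the light graph is connected.

The light graph consists of two parallel strands through `k` blocks, crossing in block `i` exactly
when `x i` and `y i` are both 1, plus one closing edge that merges the strands exactly when the
number of crossings is even (`connected_of_even`, `not_connected_of_odd`). The stream is an `x`-part
followed by a `y`-part.

By Lindsey's lemma the inner product sign sums to at most `√(8 ^ k)` on every rectangle. A pass with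
`S` bits cuts a rectangle into `4 ^ S` rectangles, so a `p`-pass algorithm has total correlation at
most `4 ^ (S * p) * √(8 ^ k)` with the sign (`StreamAlg.abs_sum_run_le`). Success probability `1 -
δ` on every input forces at least `4 ^ k * (1 - 2 * δ)`, hence `k ≤ 4 * p * S + O(1)`. -/

/-! ### Discrepancy of the inner product. -/

section Discrepancy

/-- The sign `(-1) ^ ⟨x, y⟩` of the inner product of the first `k` bits of `x` and `y`. -/
noncomputable def ipSign (k : ℕ) (x y : ℕ → Bool) : ℝ :=
  ∏ i ∈ Finset.range k, if x i && y i then -1 else 1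

/-- Extension of a bit vector by zeros. -/
def extendBits {k : ℕ} (x : Fin k → Bool) (i : ℕ) : Bool :=
  if h : i < k then x ⟨i, h⟩ else false

theorem ipSign_extendBits {k : ℕ} (x y : Fin k → Bool) :
    ipSign k (extendBits x) (extendBits y) = ∏ i, if x i && y i then (-1 : ℝ) else 1 := by
  rw [ipSign, ← Fin.prod_univ_eq_prod_range
    (fun i => if extendBits x i && extendBits y i then (-1 : ℝ) else 1)]
  simp [extendBits]

/-- Orthogonality of characters: the sum factors over coordinates, and a coordinate where `y` and
`z` differ contributes `1 - 1 = 0`. -/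
theorem sum_ipSign_mul_ipSign {k : ℕ} (y z : Fin k → Bool) :
    ∑ x : Fin k → Bool, ipSign k (extendBits x) (extendBits y) *
      ipSign k (extendBits x) (extendBits z) = if y = z then 2 ^ k else 0 := by
  simp_rw [ipSign_extendBits, ← Finset.prod_mul_distrib]
  have key := (Finset.prod_univ_sum (fun _ : Fin k => (Finset.univ : Finset Bool))
    (fun i b => (if b && y i then (-1 : ℝ) else 1) * (if b && z i then (-1 : ℝ) else 1))).symm
  rw [Fintype.piFinset_univ] at key
  rw [key]
  split_ifs with h
  · subst h
    rw [Finset.prod_congr rfl (g := fun _ => (2 : ℝ))]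
    · simp
    · intro i _
      cases y i <;> norm_num
  · obtain ⟨i, hi⟩ := Function.ne_iff.1 h
    refine Finset.prod_eq_zero (Finset.mem_univ i) ?_
    cases hy : y i <;> cases hz : z i <;> simp_all

theorem sum_sq_sum_ipSign {k : ℕ} (B : Finset (Fin k → Bool)) :
    ∑ x : Fin k → Bool, (∑ y ∈ B, ipSign k (extendBits x) (extendBits y)) ^ 2 =
      B.card * 2 ^ k := by
  simp_rw [sq, Finset.sum_mul_sum]
  rw [Finset.sum_comm]
  have h : ∀ y ∈ B, ∑ x : Fin k → Bool, ∑ z ∈ B, ipSign k (extendBits x) (extendBits y) *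
      ipSign k (extendBits x) (extendBits z) = 2 ^ k := by
    intro y hy
    rw [Finset.sum_comm]
    simp_rw [sum_ipSign_mul_ipSign]
    simp [hy]
  rw [Finset.sum_congr rfl h]
  simp

/-- Lindsey's lemma: the discrepancy of the inner product on rectangles. -/
theorem abs_sum_ipSign_le {k : ℕ} (A B : Finset (Fin k → Bool)) :
    |∑ x ∈ A, ∑ y ∈ B, ipSign k (extendBits x) (extendBits y)| ≤ √(8 ^ k) := by
  refine Real.abs_le_sqrt ?_
  have hcard : ∀ C : Finset (Fin k → Bool), (C.card : ℝ) ≤ 2 ^ k := fun C => by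
    have := C.card_le_univ
    rw [Fintype.card_fun, Fintype.card_bool, Fintype.card_fin] at this
    exact_mod_cast this
  -- Cauchy–Schwarz over `A`, then enlarge `A` to all vectors so that orthogonality applies.
  calc (∑ x ∈ A, ∑ y ∈ B, ipSign k (extendBits x) (extendBits y)) ^ 2
      ≤ A.card * ∑ x ∈ A, (∑ y ∈ B, ipSign k (extendBits x) (extendBits y)) ^ 2 :=
        sq_sum_le_card_mul_sum_sq
    _ ≤ A.card * ∑ x, (∑ y ∈ B, ipSign k (extendBits x) (extendBits y)) ^ 2 := by
        gcongr
        exact A.subset_univ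
    _ = A.card * (B.card * 2 ^ k) := by rw [sum_sq_sum_ipSign]
    _ ≤ 2 ^ k * (2 ^ k * 2 ^ k) := by
        gcongr
        · exact hcard A
        · exact hcard B
    _ = 8 ^ k := by rw [← mul_pow, ← mul_pow]; norm_num

end Discrepancy

/-! ### Streaming passes as a two-party protocol. -/

section Protocol

variable {T : Type*} {p S : ℕ}

theorem StreamAlg.runPass_append (A : StreamAlg T p S) (l l' : List T) (s : Fin S → Bool)
    (j : Fin p) :
    A.runPass (l ++ l') s j =
      (l'.zipIdx l.length).foldl (fun s x => A.step j x.2 s x.1) (A.runPass l s j) := by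
  simp [StreamAlg.runPass, List.zipIdx_append]

/-- Fixing the memory `t` at the end of the `x`-part and `u` at the end of the pass confines the
inputs to a subrectangle, on which the remaining passes all start from `u`. The common length `m` is
needed because the algorithm sees positions: those of the `y`-part must not depend on `x`. -/
theorem abs_sum_foldl_runPass_le {X Y : Type*} {M : X → Y → ℝ} {D : ℝ}
    (hM : ∀ (P : Finset X) (Q : Finset Y), |∑ x ∈ P, ∑ y ∈ Q, M x y| ≤ D)
    (A : StreamAlg T p S) {a : X → List T} {b : Y → List T} {m : ℕ}
    (ha : ∀ x, (a x).length = m) {g : (Fin S → Bool) → ℝ} (hg : ∀ s, |g s| ≤ 1)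
    (js : List (Fin p)) (s : Fin S → Bool) (P : Finset X) (Q : Finset Y) :
    |∑ x ∈ P, ∑ y ∈ Q, M x y * g (js.foldl (A.runPass (a x ++ b y)) s)| ≤
      (4 ^ S) ^ js.length * D := by
  classical
  induction js generalizing s P Q with
  | nil =>
    simp only [List.foldl_nil, List.length_nil, pow_zero, one_mul, ← Finset.sum_mul, abs_mul]
    exact (mul_le_of_le_one_right (abs_nonneg _) (hg s)).trans (hM P Q)
  | cons j js ih =>
    let f : X → Fin S → Bool := fun x => A.runPass (a x) s j
    let h : (Fin S → Bool) → Y → Fin S → Bool := fun t y =>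
      ((b y).zipIdx m).foldl (fun s x => A.step j x.2 s x.1) t
    have hsplit : ∑ x ∈ P, ∑ y ∈ Q, M x y * g ((j :: js).foldl (A.runPass (a x ++ b y)) s) =
        ∑ t, ∑ u, ∑ x ∈ P with f x = t, ∑ y ∈ Q with h t y = u,
          M x y * g (js.foldl (A.runPass (a x ++ b y)) u) := by
      rw [← Finset.sum_fiberwise P f]
      refine Finset.sum_congr rfl fun t _ => ?_
      refine Eq.trans (Finset.sum_congr rfl fun x hx => ?_) Finset.sum_comm
      rw [← Finset.sum_fiberwise Q (h t)]
      refine Finset.sum_congr rfl fun u _ => Finset.sum_congr rfl fun y hy => ?_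
      have hu : A.runPass (a x ++ b y) s j = u := by
        rw [StreamAlg.runPass_append, ha, ← (Finset.mem_filter.1 hy).2,
          ← (Finset.mem_filter.1 hx).2]
      rw [List.foldl_cons, hu]
    rw [hsplit]
    calc |∑ t, ∑ u, ∑ x ∈ P with f x = t, ∑ y ∈ Q with h t y = u,
          M x y * g (js.foldl (A.runPass (a x ++ b y)) u)|
        ≤ ∑ _t : Fin S → Bool, ∑ _u : Fin S → Bool, (4 ^ S) ^ js.length * D :=
          (Finset.abs_sum_le_sum_abs _ _).trans <| Finset.sum_le_sum fun t _ =>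
            (Finset.abs_sum_le_sum_abs _ _).trans <| Finset.sum_le_sum fun u _ => ih u _ _
      _ = (4 ^ S) ^ (j :: js).length * D := by
          have h4 : (4 : ℝ) ^ S = 2 ^ S * 2 ^ S := by rw [← mul_pow]; norm_num
          simp only [Finset.sum_const, Finset.card_univ, Fintype.card_fun, Fintype.card_bool,
            Fintype.card_fin, nsmul_eq_mul, List.length_cons, pow_succ, h4]
          push_cast
          ring

theorem StreamAlg.abs_sum_run_le {X Y : Type*} {M : X → Y → ℝ} {D : ℝ}
    (hM : ∀ (P : Finset X) (Q : Finset Y), |∑ x ∈ P, ∑ y ∈ Q, M x y| ≤ D)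
    (A : StreamAlg T p S) {a : X → List T} {b : Y → List T} {m : ℕ}
    (ha : ∀ x, (a x).length = m) {g : ℝ → ℝ} (hg : ∀ r, |g r| ≤ 1)
    (P : Finset X) (Q : Finset Y) :
    |∑ x ∈ P, ∑ y ∈ Q, M x y * g (A.run (a x ++ b y))| ≤ (4 ^ S) ^ p * D := by
  simpa [StreamAlg.run] using abs_sum_foldl_runPass_le hM A ha (b := b) (g := fun s => g (A.output s))
    (fun s => hg _) (List.finRange p) A.init P Q

theorem StreamAlg.run_eq_run_of_no_memory (A : StreamAlg T p 0) (l l' : List T) :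
    A.run l = A.run l' :=
  congrArg A.output (Subsingleton.elim _ _)

end Protocol

/-! ### MST cost with two weights. -/

section LightEdges

variable {V : Type*}

open Classical in
/-- The weights that are `1` on the edges of `L` and `W` elsewhere. -/
noncomputable def lightWeight (L : SimpleGraph V) (W : ℕ) (e : Sym2 V) : ℕ :=
  if e ∈ L.edgeSet then 1 else W

theorem mstCost_lightWeight_le [Fintype V] {L : SimpleGraph V} (hL : L.Connected) (W : ℕ) :
    mstCost ⊤ (lightWeight L W) + 1 ≤ Fintype.card V := by
  classical
  obtain ⟨T, hTL, hT⟩ := hL.exists_isTree_le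
  have hmem : totalWeight (lightWeight L W) T ∈ spanningTreeCosts ⊤ (lightWeight L W) :=
    ⟨T, le_top, hT, rfl⟩
  rw [← hT.card_edgeFinset]
  refine Nat.add_le_add_right ((Nat.sInf_le hmem).trans (le_of_eq ?_)) 1
  rw [totalWeight, Finset.card_eq_sum_ones]
  refine Finset.sum_congr (by congr!) fun e he => if_pos ?_
  exact SimpleGraph.edgeSet_mono hTL (SimpleGraph.mem_edgeFinset.1 he)

theorem le_mstCost_lightWeight [Fintype V] [Nonempty V] {L : SimpleGraph V} (hL : ¬ L.Connected)
    (W : ℕ) : W ≤ mstCost ⊤ (lightWeight L W) := by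
  classical
  obtain ⟨⟨T, -, hT, hc⟩, -⟩ := isLeast_mstCost ⊤ (lightWeight L W)
    (SimpleGraph.connected_top (V := V))
  -- A spanning tree cannot lie inside a disconnected `L`, so it uses an edge of weight `W`.
  have hTL : ¬ T ≤ L := fun h => hL (hT.connected.mono h)
  rw [← SimpleGraph.edgeSet_subset_edgeSet, Set.not_subset] at hTL
  obtain ⟨e, heT, heL⟩ := hTL
  rw [hc, totalWeight]
  calc W = lightWeight L W e := (if_neg heL).symm
    _ ≤ _ := Finset.single_le_sum (f := lightWeight L W) (fun _ _ => Nat.zero_le _)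
        (SimpleGraph.mem_edgeFinset.2 heT)

end LightEdges

/-! ### From MST estimation to connectivity. -/

section Streams

open Classical in
/-- The list of the edges of `H`, with weights `1` on the edges of `L` and `W` elsewhere. -/
noncomputable def lightStream {n : ℕ} (W : ℕ) (H L : SimpleGraph (Fin n)) :
    List (StreamEdge n) :=
  H.edgeFinset.toList.map fun e => (e, lightWeight L W e)

theorem isGraphStream_lightStream_append {n W : ℕ} {H LA LB : SimpleGraph (Fin n)} (hA : LA ≤ H)
    (hB : Disjoint LB H) :
    IsGraphStream ⊤ (lightWeight (LA ⊔ LB) W) (lightStream W H LA ++ lightStream W Hᶜ LB) := by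
  classical
  have hB' : LB ≤ Hᶜ := le_compl_iff_disjoint_right.2 hB
  have hwA : ∀ e ∈ H.edgeSet, lightWeight (LA ⊔ LB) W e = lightWeight LA W e := fun e he => by
    have : e ∉ LB.edgeSet := fun h =>
      Set.disjoint_left.1 (SimpleGraph.disjoint_edgeSet.2 hB) h he
    simp [lightWeight, SimpleGraph.edgeSet_sup, this]
  have hwB : ∀ e ∈ Hᶜ.edgeSet, lightWeight (LA ⊔ LB) W e = lightWeight LB W e := fun e he => by
    have : e ∉ LA.edgeSet := fun h =>
      Set.disjoint_left.1 (SimpleGraph.disjoint_edgeSet.2 disjoint_compl_right)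
        (SimpleGraph.edgeSet_mono hA h) he
    simp [lightWeight, SimpleGraph.edgeSet_sup, this]
  have hinj : ∀ L : SimpleGraph (Fin n),
      Function.Injective fun e : Sym2 (Fin n) => (e, lightWeight L W e) :=
    fun L e e' h => congrArg Prod.fst h
  constructor
  · refine List.Nodup.append ((Finset.nodup_toList _).map (hinj _))
      ((Finset.nodup_toList _).map (hinj _)) ?_
    intro t ht ht'
    simp only [lightStream, List.mem_map, Finset.mem_toList, SimpleGraph.mem_edgeFinset] at ht ht'
    obtain ⟨e, he, rfl⟩ := ht
    obtain ⟨e', he', h⟩ := ht'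
    obtain rfl : e' = e := congrArg Prod.fst h
    exact Set.disjoint_left.1 (SimpleGraph.disjoint_edgeSet.2 disjoint_compl_right) he he'
  · rintro ⟨e, c⟩
    have htop : e ∈ (⊤ : SimpleGraph (Fin n)).edgeSet ↔ e ∈ H.edgeSet ∨ e ∈ Hᶜ.edgeSet := by
      rw [← Set.mem_union, ← SimpleGraph.edgeSet_sup, sup_compl_eq_top]
    simp only [lightStream, List.mem_append, List.mem_map, Finset.mem_toList,
      SimpleGraph.mem_edgeFinset, Prod.mk.injEq, htop]
    constructor
    · rintro (⟨e', he', rfl, rfl⟩ | ⟨e', he', rfl, rfl⟩)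
      · exact ⟨Or.inl he', (hwA _ he').symm⟩
      · exact ⟨Or.inr he', (hwB _ he').symm⟩
    · rintro ⟨he | he, rfl⟩
      · exact Or.inl ⟨e, he, rfl, (hwA _ he).symm⟩
      · exact Or.inr ⟨e, he, rfl, (hwB _ he).symm⟩

/-- An approximation algorithm for the MST cost decides, with its error probability, whether the
graph of the edges of weight `1` is connected. -/
theorem ApproximatesMST.connectivity {n p S W : ℕ} {α δ : ℝ} {Ω : Type*} [MeasurableSpace Ω]
    {μ : Measure Ω} [IsProbabilityMeasure μ] {A : Ω → StreamAlg (StreamEdge n) p S}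
    (hA : ApproximatesMST W α δ μ A) (hα : 1 < α) (hn : 2 ≤ n) (hW : 2 * α * (n : ℝ) ≤ (W : ℝ))
    {L : SimpleGraph (Fin n)} {l : List (StreamEdge n)}
    (hl : IsGraphStream ⊤ (lightWeight L W) l) :
    Measurable (fun ω => (A ω).run l) ∧
      1 - δ ≤ μ.real {ω | (A ω).run l ≤ (n : ℝ) ↔ L.Connected} := by
  have : Nonempty (Fin n) := ⟨⟨0, by omega⟩⟩
  have hn' : (2 : ℝ) ≤ n := by exact_mod_cast hn
  have hW1 : 1 ≤ W := by
    have : (1 : ℝ) ≤ W := by nlinarith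
    exact_mod_cast this
  obtain ⟨hmeas, hprob⟩ := hA ⊤ (lightWeight L W) SimpleGraph.connected_top (fun e _ => by
    unfold lightWeight; split_ifs <;> omega) l hl
  refine ⟨hmeas, hprob.trans (measureReal_mono ?_)⟩
  rintro ω ⟨h₁, h₂⟩
  by_cases hL : L.Connected
  · have := mstCost_lightWeight_le hL W
    rw [Fintype.card_fin] at this
    have h₃ : (mstCost ⊤ (lightWeight L W) : ℝ) + 1 ≤ n := by exact_mod_cast this
    exact ⟨fun _ => hL, fun _ => by linarith⟩
  · have h₃ : (W : ℝ) ≤ mstCost ⊤ (lightWeight L W) := by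
      exact_mod_cast le_mstCost_lightWeight hL W
    -- An output `Y ≤ n` would give `2αn ≤ W ≤ αY ≤ αn`.
    refine ⟨fun h => absurd ?_ (lt_irrefl (n : ℝ)), fun h => absurd h hL⟩
    nlinarith

/-- Without memory the output ignores the stream, so being right on a connected and on a
disconnected light graph are complementary events, which cannot both have probability above 1/2.
This later absorbs additive constants. -/
theorem ApproximatesMST.memory_pos {n p S W : ℕ} {α δ : ℝ} {Ω : Type*} [MeasurableSpace Ω]
    {μ : Measure Ω} [IsProbabilityMeasure μ] {A : Ω → StreamAlg (StreamEdge n) p S}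
    (hA : ApproximatesMST W α δ μ A) (hα : 1 < α) (hδ : δ < 1 / 2) (hn : 2 ≤ n)
    (hW : 2 * α * (n : ℝ) ≤ (W : ℝ)) : 1 ≤ S := by
  by_contra! hS
  obtain rfl : S = 0 := by omega
  have : Nontrivial (Fin n) := Fin.nontrivial_iff_two_le.2 hn
  have h₁ : IsGraphStream (n := n) ⊤ (lightWeight (⊤ ⊔ ⊥) W) _ :=
    isGraphStream_lightStream_append (le_refl _) disjoint_bot_left
  have h₀ : IsGraphStream (n := n) ⊤ (lightWeight (⊥ ⊔ ⊥) W) _ :=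
    isGraphStream_lightStream_append (bot_le (a := ⊤)) disjoint_bot_left
  obtain ⟨hm₁, hp₁⟩ := hA.connectivity hα hn hW h₁
  obtain ⟨-, hp₀⟩ := hA.connectivity hα hn hW h₀
  have hbot : ¬ (⊥ : SimpleGraph (Fin n)).Connected := SimpleGraph.not_connected_bot
  have hcompl : {ω | (A ω).run (lightStream W ⊤ ⊥ ++ lightStream W ⊤ᶜ ⊥) ≤ (n : ℝ) ↔
      (⊥ ⊔ ⊥ : SimpleGraph (Fin n)).Connected} =
      {ω | (A ω).run (lightStream W ⊤ ⊤ ++ lightStream W ⊤ᶜ ⊥) ≤ (n : ℝ) ↔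
      (⊤ ⊔ ⊥ : SimpleGraph (Fin n)).Connected}ᶜ := by
    ext ω
    have hc : (⊤ : SimpleGraph (Fin n)).Connected := SimpleGraph.connected_top
    rw [Set.mem_ofPred_eq, (A ω).run_eq_run_of_no_memory
      (lightStream W ⊤ ⊥ ++ lightStream W ⊤ᶜ ⊥) (lightStream W ⊤ ⊤ ++ lightStream W ⊤ᶜ ⊥)]
    simp [hbot, hc]
  rw [hcompl, measureReal_compl] at hp₀
  · rw [probReal_univ] at hp₀
    linarith
  · exact (measurableSet_le hm₁ measurable_const).iff (MeasurableSet.const _)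

end Streams

/-! ### The strand gadget: connectivity encodes parity. -/

section Gadget

/-- The number of common ones among the first `i` bits of `x` and `y`. -/
def commonOnes (x y : ℕ → Bool) (i : ℕ) : ℕ :=
  ∑ j ∈ Finset.range i, (x j && y j).toNat

theorem commonOnes_succ (x y : ℕ → Bool) (i : ℕ) :
    commonOnes x y (i + 1) = commonOnes x y i + (x i && y i).toNat :=
  Finset.sum_range_succ _ _

theorem ipSign_eq_neg_one_pow (k : ℕ) (x y : ℕ → Bool) :
    ipSign k x y = (-1) ^ commonOnes x y k := by
  rw [ipSign, commonOnes, ← Finset.prod_pow_eq_pow_sum]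
  refine Finset.prod_congr rfl fun i _ => ?_
  cases x i && y i <;> simp

/-- The edges whose weights depend on the first input. -/
def aliceSlots (n k : ℕ) : SimpleGraph (Fin n) :=
  SimpleGraph.fromRel fun u v => ∃ i < k, ∃ s < 2, u.val = 4 * i + s ∧
    (v.val = 4 * i + 2 + s ∨ v.val = 4 * i + 4 + s)

/-- The light edges chosen by the first input. -/
def aliceGraph (n k : ℕ) (x : ℕ → Bool) : SimpleGraph (Fin n) :=
  SimpleGraph.fromRel fun u v => ∃ i < k, ∃ s < 2, u.val = 4 * i + s ∧
    ((x i = true ∧ v.val = 4 * i + 2 + s) ∨ (x i = false ∧ v.val = 4 * i + 4 + s))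

/-- The light edges chosen by the second input. -/
def bobGraph (n k : ℕ) (y : ℕ → Bool) : SimpleGraph (Fin n) :=
  SimpleGraph.fromRel fun u v =>
    (∃ i < k, ∃ s < 2, u.val = 4 * i + 2 + s ∧ v.val = 4 * i + 4 + (s + (y i).toNat) % 2) ∨
      (u.val = 1 ∧ v.val = 4 * k) ∨ (u.val = 0 ∧ 4 * k + 2 ≤ v.val)

theorem aliceGraph_le (n k : ℕ) (x : ℕ → Bool) : aliceGraph n k x ≤ aliceSlots n k := by
  intro u v h
  rw [aliceGraph, SimpleGraph.fromRel_adj] at h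
  rw [aliceSlots, SimpleGraph.fromRel_adj]
  refine ⟨h.1, h.2.imp ?_ ?_⟩ <;>
  · rintro ⟨i, hi, s, hs, h₁, h₂⟩
    exact ⟨i, hi, s, hs, h₁, h₂.imp And.right And.right⟩

theorem disjoint_bobGraph_aliceSlots (n k : ℕ) (y : ℕ → Bool) :
    Disjoint (bobGraph n k y) (aliceSlots n k) := by
  rw [SimpleGraph.disjoint_left]
  intro u v hB hA
  rw [bobGraph, SimpleGraph.fromRel_adj] at hB
  rw [aliceSlots, SimpleGraph.fromRel_adj] at hA
  obtain ⟨-, (⟨i, hi, s, hs, h₁, h₂⟩ | h) | (⟨i, hi, s, hs, h₁, h₂⟩ | h)⟩ := hB <;>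
  obtain ⟨-, ⟨i', hi', s', hs', h₁', h₂'⟩ | ⟨i', hi', s', hs', h₁', h₂'⟩⟩ := hA <;>
  omega

/-- The two-colouring of the vertices that is constant on the light components when there is an odd
number of common ones. -/
def strandColor (k : ℕ) (x y : ℕ → Bool) (v : ℕ) : ℕ :=
  if 4 * k + 2 ≤ v then 0
  else if v % 4 < 2 then (v + commonOnes x y (v / 4)) % 2
  else (v + (y (v / 4)).toNat + commonOnes x y (v / 4 + 1)) % 2

theorem strandColor_main {k : ℕ} (x y : ℕ → Bool) {i s : ℕ} (hi : i ≤ k) (hs : s < 2) :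
    strandColor k x y (4 * i + s) = (s + commonOnes x y i) % 2 := by
  have h : (4 * i + s) / 4 = i := by omega
  rw [strandColor, if_neg (by omega), if_pos (by omega), h]
  omega

theorem strandColor_middle {k : ℕ} (x y : ℕ → Bool) {i s : ℕ} (hi : i < k) (hs : s < 2) :
    strandColor k x y (4 * i + 2 + s) =
      (s + (y i).toNat + commonOnes x y (i + 1)) % 2 := by
  have h : (4 * i + 2 + s) / 4 = i := by omega
  rw [strandColor, if_neg (by omega), if_neg (by omega), h]
  omega

theorem strandColor_eq_of_alice {k : ℕ} {x y : ℕ → Bool} {u v : ℕ}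
    (h : ∃ i < k, ∃ s < 2, u = 4 * i + s ∧
      ((x i = true ∧ v = 4 * i + 2 + s) ∨ (x i = false ∧ v = 4 * i + 4 + s))) :
    strandColor k x y u = strandColor k x y v := by
  obtain ⟨i, hi, s, hs, rfl, ⟨hx, rfl⟩ | ⟨hx, rfl⟩⟩ := h
  · rw [strandColor_main x y hi.le hs, strandColor_middle x y hi hs, commonOnes_succ, hx,
      Bool.true_and]
    omega
  · rw [strandColor_main x y hi.le hs, show 4 * i + 4 + s = 4 * (i + 1) + s by ring,
      strandColor_main x y hi hs, commonOnes_succ, hx]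
    simp

theorem strandColor_eq_of_bob {k : ℕ} {x y : ℕ → Bool} (hodd : commonOnes x y k % 2 = 1) {u v : ℕ}
    (h : (∃ i < k, ∃ s < 2, u = 4 * i + 2 + s ∧ v = 4 * i + 4 + (s + (y i).toNat) % 2) ∨
      (u = 1 ∧ v = 4 * k) ∨ (u = 0 ∧ 4 * k + 2 ≤ v)) :
    strandColor k x y u = strandColor k x y v := by
  obtain ⟨i, hi, s, hs, rfl, rfl⟩ | ⟨rfl, rfl⟩ | ⟨rfl, hv⟩ := h
  · rw [strandColor_middle x y hi hs,
      show 4 * i + 4 + (s + (y i).toNat) % 2 = 4 * (i + 1) + (s + (y i).toNat) % 2 by ring,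
      strandColor_main x y (i := i + 1) hi (Nat.mod_lt _ two_pos)]
    omega
  -- The closing edge is the only place where odd parity is needed.
  · have h₁ := strandColor_main (k := k) x y (i := 0) (s := 1) (Nat.zero_le _) one_lt_two
    have h₂ := strandColor_main (k := k) x y (i := k) (s := 0) le_rfl two_pos
    simp only [mul_zero, zero_add, add_zero] at h₁ h₂
    rw [h₁, h₂, hodd]
    rfl
  · have h₁ := strandColor_main (k := k) x y (i := 0) (s := 0) (Nat.zero_le _) two_pos
    simp only [mul_zero, zero_add] at h₁
    rw [h₁, strandColor, if_pos hv]
    rfl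

theorem not_connected_of_odd {n k : ℕ} (hk : 4 * k + 2 ≤ n) {x y : ℕ → Bool}
    (hodd : commonOnes x y k % 2 = 1) : ¬ (aliceGraph n k x ⊔ bobGraph n k y).Connected := by
  intro hconn
  have hadj : ∀ u v : Fin n, (aliceGraph n k x ⊔ bobGraph n k y).Adj u v →
      strandColor k x y u = strandColor k x y v := by
    intro u v h
    rw [SimpleGraph.sup_adj, aliceGraph, bobGraph, SimpleGraph.fromRel_adj,
      SimpleGraph.fromRel_adj] at h
    obtain ⟨-, h | h⟩ | ⟨-, h | h⟩ := h
    · exact strandColor_eq_of_alice h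
    · exact (strandColor_eq_of_alice h).symm
    · exact strandColor_eq_of_bob hodd h
    · exact (strandColor_eq_of_bob hodd h).symm
  have hreach : ∀ u v : Fin n, strandColor k x y u = strandColor k x y v := by
    intro u v
    obtain ⟨q⟩ := hconn.preconnected u v
    induction q with
    | nil => rfl
    | cons h _ ih => exact (hadj _ _ h).trans ih
  have h := hreach ⟨0, by omega⟩ ⟨1, by omega⟩
  have h₀ := strandColor_main (k := k) x y (i := 0) (s := 0) (Nat.zero_le _) two_pos
  have h₁ := strandColor_main (k := k) x y (i := 0) (s := 1) (Nat.zero_le _) one_lt_two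
  simp only [mul_zero, zero_add] at h₀ h₁
  rw [h₀, h₁] at h
  simp [commonOnes] at h

theorem reachable_aliceGraph {n k : ℕ} {x : ℕ → Bool} (B : SimpleGraph (Fin n)) {u v : Fin n}
    (h : ∃ i < k, ∃ s < 2, u.val = 4 * i + s ∧
      ((x i = true ∧ v.val = 4 * i + 2 + s) ∨ (x i = false ∧ v.val = 4 * i + 4 + s))) :
    (aliceGraph n k x ⊔ B).Reachable u v := by
  refine SimpleGraph.Adj.reachable (Or.inl ?_)
  rw [aliceGraph, SimpleGraph.fromRel_adj]
  refine ⟨fun huv => ?_, Or.inl h⟩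
  obtain ⟨i, -, s, -, h₁, h₂⟩ := h
  subst huv
  omega

theorem reachable_bobGraph {n k : ℕ} {y : ℕ → Bool} (A : SimpleGraph (Fin n)) {u v : Fin n}
    (h : (∃ i < k, ∃ s < 2, u.val = 4 * i + 2 + s ∧
        v.val = 4 * i + 4 + (s + (y i).toNat) % 2) ∨
      (u.val = 1 ∧ v.val = 4 * k) ∨ (u.val = 0 ∧ 4 * k + 2 ≤ v.val)) :
    (A ⊔ bobGraph n k y).Reachable u v := by
  refine SimpleGraph.Adj.reachable (Or.inr ?_)
  rw [bobGraph, SimpleGraph.fromRel_adj]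
  refine ⟨fun huv => ?_, Or.inl h⟩
  subst huv
  obtain ⟨i, -, s, hs, h₁, h₂⟩ | h | h := h <;> omega

/-- If `x i` is 0, the strand bypasses the middle vertices and keeps its side. If `x i` is 1, it
passes through a middle vertex, whose second edge switches sides exactly when `y i` is 1. -/
theorem reachable_strand {n k : ℕ} (hk : 4 * k + 2 ≤ n) (x y : ℕ → Bool) {s : ℕ} (hs : s < 2)
    {i : ℕ} (hi : i ≤ k) (h : 4 * i + (s + commonOnes x y i) % 2 < n) :
    (aliceGraph n k x ⊔ bobGraph n k y).Reachable ⟨s, by omega⟩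
      ⟨4 * i + (s + commonOnes x y i) % 2, h⟩ := by
  induction i with
  | zero =>
    have : 4 * 0 + (s + commonOnes x y 0) % 2 = s := by
      simp [commonOnes, Nat.mod_eq_of_lt hs]
    simp only [this]
    rfl
  | succ i ih =>
    refine (ih (by omega) (by omega)).trans ?_
    have hsucc := commonOnes_succ x y i
    cases hx : x i with
    | false =>
      rw [hx, Bool.false_and, Bool.toNat_false, add_zero] at hsucc
      refine reachable_aliceGraph _ ⟨i, hi, _, Nat.mod_lt (s + commonOnes x y i) two_pos, rfl,
        Or.inr ⟨hx, ?_⟩⟩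
      change 4 * (i + 1) + (s + commonOnes x y (i + 1)) % 2 = _
      omega
    | true =>
      rw [hx, Bool.true_and] at hsucc
      refine (reachable_aliceGraph _ (v := ⟨4 * i + 2 + (s + commonOnes x y i) % 2, by omega⟩)
        ⟨i, hi, _, Nat.mod_lt (s + commonOnes x y i) two_pos, rfl, Or.inl ⟨hx, rfl⟩⟩).trans ?_
      refine reachable_bobGraph _ (Or.inl ⟨i, hi, _, Nat.mod_lt (s + commonOnes x y i) two_pos,
        rfl, ?_⟩)
      change 4 * (i + 1) + (s + commonOnes x y (i + 1)) % 2 = _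
      omega

theorem connected_of_even {n k : ℕ} (hk : 4 * k + 2 ≤ n) {x y : ℕ → Bool}
    (heven : commonOnes x y k % 2 = 0) : (aliceGraph n k x ⊔ bobGraph n k y).Connected := by
  have h01 : (aliceGraph n k x ⊔ bobGraph n k y).Reachable ⟨0, by omega⟩ ⟨1, by omega⟩ := by
    refine (reachable_strand hk x y two_pos le_rfl (by omega)).trans ?_
    refine (reachable_bobGraph _ (Or.inr (Or.inl ⟨rfl, ?_⟩))).symm
    simp [heven]
  have hstrand : ∀ s (hs : s < n), s < 2 →
      (aliceGraph n k x ⊔ bobGraph n k y).Reachable ⟨0, by omega⟩ ⟨s, hs⟩ := by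
    intro s hs hs2
    interval_cases s
    · rfl
    · exact h01
  have hmain : ∀ i ≤ k, ∀ s < 2, ∀ h : 4 * i + s < n,
      (aliceGraph n k x ⊔ bobGraph n k y).Reachable ⟨0, by omega⟩ ⟨4 * i + s, h⟩ := by
    intro i hi s hs h
    have hr : (s + commonOnes x y i) % 2 < 2 := Nat.mod_lt _ two_pos
    -- Adding the crossing count modulo 2 is an involution, so this is the strand that arrives at
    -- side `s`.
    refine (hstrand ((s + commonOnes x y i) % 2) (by omega) hr).trans ?_
    have heq : 4 * i + ((s + commonOnes x y i) % 2 + commonOnes x y i) % 2 = 4 * i + s := by omega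
    have := reachable_strand hk x y hr hi (by omega)
    simpa only [heq] using this
  have hall : ∀ v : Fin n, (aliceGraph n k x ⊔ bobGraph n k y).Reachable ⟨0, by omega⟩ v := by
    rintro ⟨v, hv⟩
    by_cases h₁ : 4 * k + 2 ≤ v
    · exact reachable_bobGraph _ (Or.inr (Or.inr ⟨rfl, h₁⟩))
    by_cases h₂ : v % 4 < 2
    · have heq : 4 * (v / 4) + v % 4 = v := by omega
      have := hmain (v / 4) (by omega) (v % 4) h₂ (by omega)
      simpa only [heq] using this
    · have hr : (v % 4 - 2 + (y (v / 4)).toNat) % 2 < 2 := Nat.mod_lt _ two_pos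
      refine (hmain (v / 4 + 1) (by omega) _ hr (by omega)).trans ?_
      refine (reachable_bobGraph _ (Or.inl ⟨v / 4, by omega, v % 4 - 2, by omega, ?_, ?_⟩)).symm
      · change v = _
        omega
      · ring
  have : Nonempty (Fin n) := ⟨⟨0, by omega⟩⟩
  exact ⟨fun u v => (hall u).symm.trans (hall v)⟩

theorem ipSign_mul_sign_eq {n k : ℕ} (hk : 4 * k + 2 ≤ n) (x y : ℕ → Bool) (q : Prop)
    [Decidable q] [Decidable (q ↔ (aliceGraph n k x ⊔ bobGraph n k y).Connected)] :
    ipSign k x y * (if q then 1 else -1) =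
      if (q ↔ (aliceGraph n k x ⊔ bobGraph n k y).Connected) then 1 else -1 := by
  rw [ipSign_eq_neg_one_pow]
  rcases Nat.mod_two_eq_zero_or_one (commonOnes x y k) with h | h
  · have hc := connected_of_even hk h
    rw [Even.neg_one_pow (Nat.even_iff.2 h)]
    by_cases hq : q <;> simp [hc, hq]
  · have hc := not_connected_of_odd hk h
    rw [Odd.neg_one_pow (Nat.odd_iff.2 h)]
    by_cases hq : q <;> simp [hc, hq]

end Gadget

/-! ### Averaging over inputs and the final bound. -/

section LowerBound

theorem integral_sign_eq {Ω : Type*} [MeasurableSpace Ω] (μ : Measure Ω) [IsProbabilityMeasure μ]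
    {E : Set Ω} [DecidablePred (· ∈ E)] (hE : MeasurableSet E) :
    Integrable (fun ω => if ω ∈ E then (1 : ℝ) else -1) μ ∧
      ∫ ω, (if ω ∈ E then (1 : ℝ) else -1) ∂μ = 2 * μ.real E - 1 := by
  have hind : Integrable (E.indicator fun _ => (2 : ℝ)) μ := (integrable_const 2).indicator hE
  have hfun : (fun ω => if ω ∈ E then (1 : ℝ) else -1) =
      fun ω => E.indicator (fun _ => (2 : ℝ)) ω - 1 := by
    funext ω
    by_cases h : ω ∈ E <;> norm_num [h]
  rw [hfun]
  refine ⟨hind.sub (integrable_const 1), ?_⟩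
  rw [integral_sub hind (integrable_const 1), integral_indicator_const _ hE]
  simp [mul_comm]

theorem ApproximatesMST.discrepancy_bound {n p S W : ℕ} {α δ : ℝ} {Ω : Type*} [MeasurableSpace Ω]
    {μ : Measure Ω} [IsProbabilityMeasure μ] {A : Ω → StreamAlg (StreamEdge n) p S}
    (hA : ApproximatesMST W α δ μ A) (hα : 1 < α) (hn : 2 ≤ n) (hW : 2 * α * (n : ℝ) ≤ (W : ℝ))
    {k : ℕ} (hk : 4 * k + 2 ≤ n) :
    4 ^ k * (1 - 2 * δ) ≤ (4 ^ S) ^ p * √(8 ^ k) := by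
  classical
  let a : (Fin k → Bool) → List (StreamEdge n) := fun x =>
    lightStream W (aliceSlots n k) (aliceGraph n k (extendBits x))
  let b : (Fin k → Bool) → List (StreamEdge n) := fun y =>
    lightStream W (aliceSlots n k)ᶜ (bobGraph n k (extendBits y))
  let g : ℝ → ℝ := fun r => if r ≤ (n : ℝ) then 1 else -1
  have hg : ∀ r, |g r| ≤ 1 := fun r => by
    simp only [g]
    split_ifs <;> simp
  let F : (Fin k → Bool) → (Fin k → Bool) → Ω → ℝ := fun x y ω =>
    ipSign k (extendBits x) (extendBits y) * g ((A ω).run (a x ++ b y))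
  have hF : ∀ x y, Integrable (F x y) μ ∧ 1 - 2 * δ ≤ ∫ ω, F x y ω ∂μ := by
    intro x y
    obtain ⟨hm, hp⟩ := hA.connectivity hα hn hW (isGraphStream_lightStream_append (W := W)
      (aliceGraph_le n k (extendBits x)) (disjoint_bobGraph_aliceSlots n k (extendBits y)))
    let E : Set Ω := {ω | (A ω).run (a x ++ b y) ≤ (n : ℝ) ↔
      (aliceGraph n k (extendBits x) ⊔ bobGraph n k (extendBits y)).Connected}
    have hE : MeasurableSet E := (measurableSet_le hm measurable_const).iff (MeasurableSet.const _)
    obtain ⟨hi, he⟩ := integral_sign_eq μ hE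
    have hfun : F x y = fun ω => if ω ∈ E then (1 : ℝ) else -1 := by
      funext ω
      exact ipSign_mul_sign_eq hk _ _ _
    rw [hfun]
    refine ⟨hi, ?_⟩
    rw [he]
    have hp' : 1 - δ ≤ μ.real E := hp
    linarith
  have hcard : (Finset.univ : Finset (Fin k → Bool)).card = 2 ^ k := by simp
  calc (4 : ℝ) ^ k * (1 - 2 * δ)
      = ∑ _x : Fin k → Bool, ∑ _y : Fin k → Bool, (1 - 2 * δ) := by
        have h4 : (4 : ℝ) ^ k = 2 ^ k * 2 ^ k := by rw [← mul_pow]; norm_num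
        simp only [Finset.sum_const, hcard, nsmul_eq_mul, h4]
        push_cast
        ring
    _ ≤ ∑ x, ∑ y, ∫ ω, F x y ω ∂μ :=
        Finset.sum_le_sum fun x _ => Finset.sum_le_sum fun y _ => (hF x y).2
    _ = ∫ ω, ∑ x, ∑ y, F x y ω ∂μ := by
        rw [integral_finsetSum _ fun x _ => integrable_finsetSum _ fun y _ => (hF x y).1]
        exact Finset.sum_congr rfl fun x _ => (integral_finsetSum _ fun y _ => (hF x y).1).symm
    -- The correlation bound holds for each deterministic algorithm, hence pointwise in `ω`.
    _ ≤ ∫ _ω, (4 ^ S) ^ p * √(8 ^ k) ∂μ := by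
        refine integral_mono (integrable_finsetSum _ fun x _ =>
          integrable_finsetSum _ fun y _ => (hF x y).1) (integrable_const _) fun ω => ?_
        exact (le_abs_self _).trans ((A ω).abs_sum_run_le (fun P Q => abs_sum_ipSign_le P Q)
          (m := (aliceSlots n k).edgeFinset.toList.length) (fun x => by simp [a, lightStream])
          hg _ _)
    _ = (4 ^ S) ^ p * √(8 ^ k) := by simp

theorem ApproximatesMST.bits_le {n p S W : ℕ} {α δ : ℝ} {Ω : Type*} [MeasurableSpace Ω]
    {μ : Measure Ω} [IsProbabilityMeasure μ] {A : Ω → StreamAlg (StreamEdge n) p S}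
    (hA : ApproximatesMST W α δ μ A) (hα : 1 < α) (hδ : δ < 1 / 2) (hn : 2 ≤ n)
    (hW : 2 * α * (n : ℝ) ≤ (W : ℝ)) {k m : ℕ} (hk : 4 * k + 2 ≤ n)
    (hm : (1 / 2 : ℝ) ^ m < (1 - 2 * δ) ^ 2) : k ≤ 4 * (p * S) + m := by
  have h := hA.discrepancy_bound hα hn hW hk
  have hpos : 0 ≤ 4 ^ k * (1 - 2 * δ) := mul_nonneg (by positivity) (by linarith)
  have hsq := pow_le_pow_left₀ hpos h 2
  -- Squaring and cancelling `8 ^ k` leaves `2 ^ k * (1 - 2 * δ) ^ 2 ≤ 2 ^ (4 * (p * S))`.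
  rw [mul_pow, mul_pow, Real.sq_sqrt (by positivity)] at hsq
  have h16 : ((4 : ℝ) ^ k) ^ 2 = 8 ^ k * 2 ^ k := by
    rw [← pow_mul, mul_comm k 2, pow_mul, ← mul_pow]
    norm_num
  have hS : (((4 : ℝ) ^ S) ^ p) ^ 2 = 2 ^ (4 * (p * S)) := by
    rw [← pow_mul, ← pow_mul, show (4 : ℝ) = 2 ^ 2 by norm_num, ← pow_mul]
    congr 1
    ring
  rw [h16, hS, mul_assoc, mul_comm (2 ^ (4 * (p * S))) ((8 : ℝ) ^ k)] at hsq
  have h₂ := le_of_mul_le_mul_left hsq (by positivity)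
  have h₃ : (2 : ℝ) ^ k ≤ 2 ^ (4 * (p * S) + m) := by
    have h₄ : (2 : ℝ) ^ k * (1 / 2) ^ m ≤ 2 ^ (4 * (p * S)) :=
      (mul_le_mul_of_nonneg_left hm.le (by positivity)).trans h₂
    rwa [one_div, inv_pow, ← div_eq_mul_inv, div_le_iff₀ (by positivity), ← pow_add] at h₄
  exact (pow_le_pow_iff_right₀ one_lt_two).1 h₃

end LowerBound

theorem mainTheorem8 (δ : ℝ) (hδ₀ : 0 ≤ δ) (hδ : δ < 1 / 2) :
    ∃ c : ℝ, 0 < c ∧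
      ∀ (α : ℝ), 1 < α → ∀ (n p S W : ℕ), 2 ≤ n → 1 ≤ p → 2 * α * (n : ℝ) ≤ (W : ℝ) →
        ∀ {Ω : Type*} [MeasurableSpace Ω] (μ : Measure Ω) [IsProbabilityMeasure μ]
          (A : Ω → StreamAlg (StreamEdge n) p S),
          ApproximatesMST W α δ μ A → c * ((n : ℝ) / (p : ℝ)) ≤ (S : ℝ) := by
  have hpos : (0 : ℝ) < (1 - 2 * δ) ^ 2 := by
    have : 0 < 1 - 2 * δ := by linarith
    positivity
  obtain ⟨m, hm⟩ := exists_pow_lt_of_lt_one hpos (by norm_num : (1 / 2 : ℝ) < 1)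
  -- With `k = (n - 2) / 4` one has `n ≤ 4k + 5 ≤ 16pS + 4m + 5`, and `pS ≥ 1` turns this into `n ≤
  -- (4m + 21)pS`.
  refine ⟨1 / (4 * m + 21), by positivity, ?_⟩
  intro α hα n p S W hn hp hW Ω _ μ _ A hA
  have hS : 1 ≤ S := hA.memory_pos hα hδ hn hW
  have hk := hA.bits_le hα hδ hn hW (k := (n - 2) / 4) (by omega) hm
  have hpS : 1 ≤ p * S := Nat.mul_pos hp hS
  have hbound : n ≤ (4 * m + 21) * (p * S) := by
    have : m ≤ m * (p * S) := Nat.le_mul_of_pos_right m hpS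
    have : (4 * m + 21) * (p * S) = 4 * (m * (p * S)) + 21 * (p * S) := by ring
    omega
  have hboundR : (n : ℝ) ≤ (4 * m + 21) * (p * S) := by exact_mod_cast hbound
  have hp0 : (0 : ℝ) < p := by exact_mod_cast hp
  rw [div_mul_div_comm, one_mul, div_le_iff₀ (by positivity)]
  linarith
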